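/- \textbf{Setting.} Let $\mathbb U$ be a non-empty set and assign to every attribute name $A$ a domain $\operatorname{dom}(A)\subseteq\mathbb U$ equipped with a Polish topology and its Borel $\sigma$-algebra. A schema $\tau$ consists of finitely many relation symbols $R$, each with a (possibly empty) tuple $(A_1,\dots,A_k)$ of pairwise distinct attribute names. The $R$-tuples form the product space $\operatorname{dom}(A_1)\times\dots\times\operatorname{dom}(A_k)$ with the product $\sigma$-algebra, and the space $\mathbb F_\tau$ of $\tau$-facts $R(t)$ is the disjoint union of these spaces over all $R\in\tau$, with the disjoint union $\sigma$-algebra. The measurable space $\mathbb{DB}_\tau$ of instances of standard probabilistic databases is the set of all finite bags over $\mathbb F_\tau$, with the $\sigma$-algebra generated by the events that a bag has exactly $n$ elements (counted with multiplicity) in $F$, for measurable $F\subseteq\mathbb F_\tau$ and $n\in\mathbb N$. \textbf{Datalog.} Let $\tau$ be an input schema and $\iota$ a schema of intensional relation symbols (disjoint from $\tau$). A Datalog program is a finite set of rules $H\leftarrow B_1,\dots,B_m$ ($m\ge 0$), where $H$ is an atom over $\iota$ and the $B_j$ are atoms over $\tau$ or $\iota$; the arguments of atoms are variables or constants from $\mathbb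 U$, and every variable of $H$ occurs in some $B_j$. A valuation of the variables in $\mathbb U$ turns an atom into a fact provided that the resulting values lie in the attribute domains. Given a finite set $D$ of $\tau$-facts, let $P(D)$ be the least set $I$ of $\iota$-facts such that, for every rule and every valuation for which all body atoms become facts of $D\cup I$ and the head becomes a fact, this head fact belongs to $I$. For an output relation symbol $R\in\iota$, the Datalog query $Q_{P,R}$ maps an instance $D\in\mathbb{DB}_\tau$ to the instance, over the schema consisting of a single relation symbol with the sort of $R$, that contains exactly once each tuple $t$ with $R(t)\in P(D')$, where $D'$ is the set of facts occurring in $D$ (set semantics: multiplicities are ignored). The set of these tuples is always finite. Variables may only compare values that can be compared measurably: whenever, in a rule of the program, the same variable occurs at positions with attributes $A$ and $B$, the set $\{(a,b)\in\operatorname{dom}(A)\times\operatorname{dom}(B): a=b\}$ is measurable in the product $\sigma$-algebra. (This always holds if $\operatorname{dom}(A)$ and $\operatorname{dom}(B)$ are the same Polish space, if they are disjoint, or if they are Borel subspaces of a common Polish space.) \textbf{Statement (Every Datalog query is measurable).} For every Datalog program $P$ over $\tau$ and $\iota$ as above and every $R\in\iota$, the query $Q_{P,R}$ is a measurable map from $\mathbb{DB}_\tau$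 to the space of instances over the output schema. -/

import Mathlib

/-! ### Sorted universes, schemas, facts and database instances -/

/-- A sorted universe with attribute names `Att`, all of whose attribute domains are Polish. -/
structure SortedUniverse (Att : Type*) where
  carrier : Type*
  nonempty : Nonempty carrier
  dom : Att → Set carrier
  topology : ∀ A, TopologicalSpace (dom A)
  polish : ∀ A, PolishSpace (dom A)

instance SortedUniverse.instTopology {Att : Type*} (U : SortedUniverse Att) (A : Att) :
    TopologicalSpace (U.dom A) := U.topology A

instance SortedUniverse.instPolish {Att : Type*} (U : SortedUniverse Att) (A : Att) :
    PolishSpace (U.dom A) := U.polish A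

/-- Every attribute domain carries its Borel σ-algebra. -/
instance SortedUniverse.instMeasurableSpace {Att : Type*} (U : SortedUniverse Att) (A : Att) :
    MeasurableSpace (U.dom A) := borel (U.dom A)

instance SortedUniverse.instBorelSpace {Att : Type*} (U : SortedUniverse Att) (A : Att) :
    BorelSpace (U.dom A) := ⟨rfl⟩

/-- A database schema: finitely many relation symbols, each with a sort, that is, a (possibly
empty) tuple of pairwise distinct attribute names. -/
structure Schema (Att : Type*) where
  Rel : Type
  finite : Finite Rel
  sort : Rel → List Att
  nodup : ∀ R, (sort R).Nodup

/-- The schema whose only relation symbol has the sort of `R`. -/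
def Schema.single {Att : Type*} (τ : Schema Att) (R : τ.Rel) : Schema Att where
  Rel := Unit
  finite := inferInstance
  sort := fun _ => τ.sort R
  nodup := fun _ => τ.nodup R

/-- The number of attributes in the sort of a relation symbol. -/
abbrev Schema.arity {Att : Type*} (τ : Schema Att) (R : τ.Rel) : ℕ := (τ.sort R).length

/-- The attribute at position `i` of the relation symbol `R`. -/
abbrev Schema.attr {Att : Type*} (τ : Schema Att) (R : τ.Rel) (i : Fin (τ.arity R)) : Att :=
  (τ.sort R).get i

/-- The `R`-tuples: the product of the attribute domains, with the product σ-algebra. -/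
abbrev RelTuple {Att : Type*} (U : SortedUniverse Att) (τ : Schema Att) (R : τ.Rel) : Type _ :=
  ∀ i : Fin (τ.arity R), U.dom (τ.attr R i)

/-- The facts over a schema: the disjoint union over the relation symbols `R` of the spaces of
`R`-tuples, with the disjoint union σ-algebra. -/
abbrev DBFact {Att : Type*} (U : SortedUniverse Att) (τ : Schema Att) : Type _ :=
  Σ R : τ.Rel, RelTuple U τ R

open Classical in
/-- The number of elements of the bag `B` in the set `F`, counted with multiplicities. -/
noncomputable def bagCount {X : Type*} (B : Multiset X) (F : Set X) : ℕ :=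
  B.countP (fun x => x ∈ F)

/-- The counting σ-algebra on the finite bags over a measurable space, generated by the events
that a bag has exactly `n` elements in a measurable set `F`. -/
@[reducible]
def countingSigmaAlgebra (X : Type*) [MeasurableSpace X] : MeasurableSpace (Multiset X) :=
  MeasurableSpace.generateFrom
    {E | ∃ F : Set X, MeasurableSet F ∧ ∃ n : ℕ, E = {B | bagCount B F = n}}

/-- Database instances: finite bags of facts. -/
def DBInstance {Att : Type*} (U : SortedUniverse Att) (τ : Schema Att) : Type _ :=
  Multiset (DBFact U τ)

/-- The measurable space underlying all standard probabilistic databases over `τ` and `U`. -/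
instance DBInstance.instMeasurableSpace {Att : Type*} (U : SortedUniverse Att)
    (τ : Schema Att) : MeasurableSpace (DBInstance U τ) :=
  countingSigmaAlgebra (DBFact U τ)

/-- The set of the facts that occur in a database instance. -/
def DBInstance.facts {Att : Type*} {U : SortedUniverse Att} {τ : Schema Att}
    (D : DBInstance U τ) : Set (DBFact U τ) :=
  {f | f ∈ (show Multiset (DBFact U τ) from D)}

/-! ### Datalog -/

/-- Terms: variables, named by natural numbers, and constants from the universe. -/
inductive DTerm (C : Type*) where
  | var (x : ℕ) : DTerm C
  | const (c : C) : DTerm C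

/-- The value of a term under a valuation of the variables. -/
def DTerm.eval {C : Type*} (v : ℕ → C) : DTerm C → C
  | .var x => v x
  | .const c => c

/-- An atom `R(u₁, …, uₖ)` over a schema. -/
structure DAtom {Att : Type*} (U : SortedUniverse Att) (τ : Schema Att) where
  rel : τ.Rel
  args : Fin (τ.arity rel) → DTerm U.carrier

section Atoms

variable {Att : Type*} {U : SortedUniverse Att} {τ : Schema Att}

/-- The fact `f` is the ground instance of the atom `a` under the valuation `v`. (If a value
lies outside the domain of its attribute, then there is no such fact.) -/
def DAtom.IsInstance (a : DAtom U τ) (v : ℕ → U.carrier) (f : DBFact U τ) : Prop :=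
  ∃ t : RelTuple U τ a.rel,
    f = ⟨a.rel, t⟩ ∧ ∀ i, (t i : U.carrier) = (a.args i).eval v

/-- The ground instance of `a` under `v` is one of the facts in `I`. -/
def DAtom.Holds (a : DAtom U τ) (v : ℕ → U.carrier) (I : Set (DBFact U τ)) : Prop :=
  ∃ f ∈ I, a.IsInstance v f

/-- The variable `x` occurs in the atom `a` at a position with attribute `A`. -/
def DAtom.OccursAt (a : DAtom U τ) (x : ℕ) (A : Att) : Prop :=
  ∃ i, a.args i = DTerm.var x ∧ τ.attr a.rel i = A

end Atoms

/-- A Datalog rule with input (extensional) schema `τ` and intensional schema `ι`. The head is an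
intensional atom. The body is finite and may be empty; its extensional atoms and its intensional
atoms are listed separately. Every variable of the head occurs in the body. -/
structure DRule {Att : Type*} (U : SortedUniverse Att) (τ ι : Schema Att) where
  head : DAtom U ι
  edb : List (DAtom U τ)
  idb : List (DAtom U ι)
  safe : ∀ x A, head.OccursAt x A →
    (∃ a ∈ edb, ∃ B, a.OccursAt x B) ∨ (∃ a ∈ idb, ∃ B, a.OccursAt x B)

/-- The variable `x` occurs in the rule, in its head or body, at a position with attribute `A`. -/
def DRule.OccursAt {Att : Type*} {U : SortedUniverse Att} {τ ι : Schema Att}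
    (r : DRule U τ ι) (x : ℕ) (A : Att) : Prop :=
  r.head.OccursAt x A ∨ (∃ a ∈ r.edb, a.OccursAt x A) ∨ (∃ a ∈ r.idb, a.OccursAt x A)

/-- A Datalog program: a finite collection of rules. -/
structure DatalogProgram {Att : Type*} (U : SortedUniverse Att) (τ ι : Schema Att) where
  rules : List (DRule U τ ι)

namespace DatalogProgram

variable {Att : Type*} {U : SortedUniverse Att} {τ ι : Schema Att}

/-- Two attributes have Borel equality if the set of pairs `(a, b)` with `a = b` is measurable in
the product of the two domains. This holds if both attributes have the same Polish domain, if
their domains are disjoint, or if they are Borel subspaces of one Polish space. -/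
def BorelEquality (U : SortedUniverse Att) (A B : Att) : Prop :=
  MeasurableSet {p : U.dom A × U.dom B | (p.1 : U.carrier) = (p.2 : U.carrier)}

/-- The variables of a rule only compare values of attributes with Borel equality. -/
def WellSorted (P : DatalogProgram U τ ι) : Prop :=
  ∀ r ∈ P.rules, ∀ (x : ℕ) (A B : Att), r.OccursAt x A → r.OccursAt x B → BorelEquality U A B

/-- The immediate consequence operator, for a fixed set `D` of input facts: it maps a set `I` of
intensional facts to the set of the heads of all ground rules with true bodies in `D` and `I`. -/
def consequence (P : DatalogProgram U τ ι) (D : Set (DBFact U τ)) :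
    Set (DBFact U ι) →o Set (DBFact U ι) where
  toFun I := {f | ∃ r ∈ P.rules, ∃ v : ℕ → U.carrier,
    (∀ a ∈ r.edb, a.Holds v D) ∧ (∀ a ∈ r.idb, a.Holds v I) ∧ r.head.IsInstance v f}
  monotone' := by
    rintro I J hIJ f ⟨r, hr, v, h1, h2, h3⟩
    refine ⟨r, hr, v, h1, fun a ha => ?_, h3⟩
    obtain ⟨g, hg, hag⟩ := h2 a ha
    exact ⟨g, hIJ hg, hag⟩

/-- The intensional facts derived by the program: the least fixpoint of the immediate
consequence operator. -/
def derived (P : DatalogProgram U τ ι) (D : Set (DBFact U τ)) : Set (DBFact U ι) :=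
  OrderHom.lfp (P.consequence D)

/-- The constants in the heads of the rules. -/
def constants (P : DatalogProgram U τ ι) : Set U.carrier :=
  ⋃ r ∈ {r | r ∈ P.rules}, {c | ∃ i, r.head.args i = DTerm.const c}

/-- The values that occur in a set of input facts. -/
def activeDomain (D : Set (DBFact U τ)) : Set U.carrier :=
  ⋃ f ∈ D, Set.range (fun i => ((f.2 i : U.dom _) : U.carrier))

theorem constants_finite (P : DatalogProgram U τ ι) : P.constants.Finite := by
  refine Set.Finite.biUnion (List.finite_toSet P.rules) fun r _ => ?_
  refine (Set.finite_range (fun i => (r.head.args i).eval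
    (fun _ => U.nonempty.some))).subset ?_
  rintro c ⟨i, hi⟩
  exact ⟨i, by simp [hi, DTerm.eval]⟩

theorem activeDomain_finite {D : Set (DBFact U τ)} (hD : D.Finite) : (activeDomain D).Finite :=
  hD.biUnion fun _ _ => Set.finite_range _

/-- There are only finitely many facts with values in a finite set. -/
theorem facts_finite (σ : Schema Att) {S : Set U.carrier} (hS : S.Finite) :
    {f : DBFact U σ | ∀ i, ((f.2 i : U.dom _) : U.carrier) ∈ S}.Finite := by
  have : Finite σ.Rel := σ.finite
  have : Finite S := hS
  let φ : {f : DBFact U σ | ∀ i, ((f.2 i : U.dom _) : U.carrier) ∈ S} →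
      Σ R : σ.Rel, (Fin (σ.arity R) → S) := fun f => ⟨f.1.1, fun i => ⟨_, f.2 i⟩⟩
  refine Finite.of_injective φ ?_
  rintro ⟨⟨R, t⟩, ht⟩ ⟨⟨R', t'⟩, ht'⟩ h
  simp only [φ, Sigma.mk.injEq] at h
  obtain ⟨rfl, h⟩ := h
  have h := eq_of_heq h
  have : t = t' := funext fun i => Subtype.ext
    (congrArg (fun s : S => (s : U.carrier)) (congrFun h i))
  subst this
  rfl

theorem derived_finite (P : DatalogProgram U τ ι) {D : Set (DBFact U τ)} (hD : D.Finite) :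
    (P.derived D).Finite := by
  set S := activeDomain D ∪ P.constants
  refine (facts_finite ι (S := S) ((activeDomain_finite hD).union P.constants_finite)).subset ?_
  refine OrderHom.lfp_le (P.consequence D) ?_
  rintro f ⟨r, hr, v, hD', hI, t, rfl, ht⟩ i
  change ((t i : U.dom _) : U.carrier) ∈ S
  rw [ht i]
  cases hi : r.head.args i with
  | const c => exact Or.inr (Set.mem_biUnion hr ⟨i, hi⟩)
  | var x =>
    rcases r.safe x _ ⟨i, hi, rfl⟩ with ⟨a, ha, B, j, hj, -⟩ | ⟨a, ha, B, j, hj, -⟩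
    · obtain ⟨g, hg, s, rfl, hs⟩ := hD' a ha
      have h := hs j
      rw [hj] at h
      exact Or.inl (Set.mem_biUnion hg ⟨j, h⟩)
    · obtain ⟨g, hg, s, rfl, hs⟩ := hI a ha
      have h := hs j
      rw [hj] at h
      exact h ▸ hg j

/-- The answers of the Datalog query with output relation `R`. -/
def answers (P : DatalogProgram U τ ι) (R : ι.Rel) (D : DBInstance U τ) :
    Set (DBFact U (ι.single R)) :=
  {f | (⟨R, f.2⟩ : DBFact U ι) ∈ P.derived D.facts}

theorem answers_finite (P : DatalogProgram U τ ι) (R : ι.Rel) (D : DBInstance U τ) :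
    (P.answers R D).Finite := by
  have hD : D.facts.Finite := Multiset.finite_toSet (show Multiset (DBFact U τ) from D)
  refine Set.Finite.preimage (f := fun f : DBFact U (ι.single R) => (⟨R, f.2⟩ : DBFact U ι))
    (Function.Injective.injOn ?_) (P.derived_finite hD)
  rintro ⟨⟨⟩, t⟩ ⟨⟨⟩, t'⟩ h
  have h : t = t' := eq_of_heq (Sigma.mk.inj h).2
  rw [h]

/-- The Datalog query with output relation `R` under set semantics, as a map between spaces of
database instances: multiplicities in the input are ignored, and every answer has multiplicity
one in the output. -/
noncomputable def query (P : DatalogProgram U τ ι) (R : ι.Rel) (D : DBInstance U τ) :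
    DBInstance U (ι.single R) :=
  (P.answers_finite R D).toFinset.val

end DatalogProgram

open MeasureTheory Set

/-! ### Disjoint unions of standard Borel spaces -/

section Sigma

variable {κ : Type*} {E : κ → Type*} [∀ k, MeasurableSpace (E k)]

/-! A rule application hides existential quantifiers, and projections of Borel sets need not be
Borel. They are when the projection is injective on the set (Lusin–Souslin). So all sets of facts
are carried as countable unions of graphs of Borel partial functions of a parameter `ω`:
`CountablyUniformized`. This class is closed under countable unions, finite products and
`CountablyUniformized.comp`, and the number of elements of such a family depends measurably on `ω`.

A rule fits in: its head is determined by its body tuples because it is safe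
(`injOn_fst_groundRule`), and this partial function is Borel because its variables compare values
measurably (`measurableSet_groundRule`). One round thus preserves the class, and the least fixpoint
is a countable union of rounds.

Lusin–Souslin needs a standard Borel parameter space. Instances are therefore replaced by codes in
`κ → ℕ` with `κ` countable: counts of the bag on intersections of two basic open sets
(`exists_measurable_code`). -/

theorem measurableSet_sigma_iff {s : Set (Σ k, E k)} :
    MeasurableSet s ↔ ∀ k, MeasurableSet (Sigma.mk k ⁻¹' s) :=
  MeasurableSpace.measurableSet_iInf

theorem measurable_sigmaMk (k : κ) : Measurable (Sigma.mk k : E k → Σ k, E k) :=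
  fun _ hs => measurableSet_sigma_iff.1 hs k

theorem measurable_of_forall_sigmaMk {Y : Type*} [MeasurableSpace Y] {f : (Σ k, E k) → Y}
    (hf : ∀ k, Measurable fun x => f ⟨k, x⟩) : Measurable f :=
  fun _ hs => measurableSet_sigma_iff.2 fun k => hf k hs

/-- For Polish topologies on the summands, the disjoint union topology is Polish, and its Borel sets
are the disjoint union σ-algebra because every summand is openly embedded. -/
theorem standardBorelSpace_sigma [Countable κ] [∀ k, StandardBorelSpace (E k)] :
    StandardBorelSpace (Σ k, E k) := by
  let _ := fun k => upgradeStandardBorel (E k)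
  have : BorelSpace (Σ k, E k) := by
    refine ⟨le_antisymm (fun s hs => ?_) ?_⟩
    · have hs' : s = ⋃ k, Sigma.mk k '' (Sigma.mk k ⁻¹' s) := by
        ext ⟨k, x⟩
        simp only [mem_iUnion, mem_image, mem_preimage]
        exact ⟨fun h => ⟨k, x, h, rfl⟩, fun ⟨j, y, hy, h⟩ => h ▸ hy⟩
      rw [hs']
      let _ : MeasurableSpace (Σ k, E k) := borel _
      have : BorelSpace (Σ k, E k) := ⟨rfl⟩
      exact MeasurableSet.iUnion fun k =>
        (Topology.IsOpenEmbedding.sigmaMk.measurableEmbedding).measurableSet_image.2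
          (measurableSet_sigma_iff.1 hs k)
    · refine MeasurableSpace.generateFrom_le fun s hs => measurableSet_sigma_iff.2 fun k => ?_
      exact (isOpen_sigma_iff.1 hs k).measurableSet
  have : PolishSpace (Σ k, E k) := { }
  infer_instance

end Sigma

/-! ### Families of sets that are countable unions of Borel partial functions -/

/-- A family of subsets of `Y` indexed by `Ω` is countably uniformized if its graph is a countable
union of graphs of partial functions that are measurable subsets of `Ω × Y`. -/
def CountablyUniformized {Ω Y : Type*} [MeasurableSpace Ω] [MeasurableSpace Y]
    (G : Ω → Set Y) : Prop :=
  ∃ g : ℕ → Set (Ω × Y), (∀ n, MeasurableSet (g n)) ∧ (∀ n, InjOn Prod.fst (g n)) ∧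
    ∀ ω y, y ∈ G ω ↔ ∃ n, (ω, y) ∈ g n

namespace CountablyUniformized

variable {Ω Y Z : Type*} [MeasurableSpace Ω] [MeasurableSpace Y] [MeasurableSpace Z]

theorem of_countable {κ : Type*} [Countable κ] {G : Ω → Set Y} (g : κ → Set (Ω × Y))
    (hg : ∀ k, MeasurableSet (g k)) (hi : ∀ k, InjOn Prod.fst (g k))
    (hG : ∀ ω y, y ∈ G ω ↔ ∃ k, (ω, y) ∈ g k) : CountablyUniformized G := by
  cases isEmpty_or_nonempty κ with
  | inl _ => exact ⟨fun _ => ∅, by simp, by simp, by simp [hG]⟩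
  | inr _ =>
    obtain ⟨e, he⟩ := exists_surjective_nat κ
    exact ⟨fun n => g (e n), fun n => hg _, fun n => hi _, fun ω y => by rw [hG, he.exists]⟩

theorem iUnion {κ : Type*} [Countable κ] {G : κ → Ω → Set Y}
    (hG : ∀ k, CountablyUniformized (G k)) : CountablyUniformized fun ω => ⋃ k, G k ω := by
  choose g hg hi h using hG
  refine of_countable (κ := κ × ℕ) (fun p => g p.1 p.2) (fun p => hg _ _) (fun p => hi _ _) ?_
  simp [h]

theorem inter {G : Ω → Set Y} (hG : CountablyUniformized G) {s : Set Y} (hs : MeasurableSet s) :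
    CountablyUniformized fun ω => G ω ∩ s := by
  obtain ⟨g, hg, hi, h⟩ := hG
  refine ⟨fun n => g n ∩ Prod.snd ⁻¹' s, fun n => (hg n).inter (measurable_snd hs),
    fun n => (hi n).mono inter_subset_left, ?_⟩
  simp [h]

theorem preimage {G : Ω → Set Z} (hG : CountablyUniformized G) {φ : Y → Z} (hφ : Measurable φ)
    (hφi : Function.Injective φ) : CountablyUniformized fun ω => φ ⁻¹' G ω := by
  obtain ⟨g, hg, hi, h⟩ := hG
  refine ⟨fun n => Prod.map id φ ⁻¹' g n, fun n => (measurable_id.prodMap hφ) (hg n), ?_, ?_⟩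
  · rintro n ⟨ω, y⟩ hy ⟨ω', y'⟩ hy' rfl
    have := hi n hy hy' rfl
    simp only [Prod.map_apply, id_eq, Prod.mk.injEq, true_and] at this
    rw [hφi this]
  · simp [h]

/-- Pick one partial function per coordinate; finiteness of `κ` keeps the set of choices countable.
-/
theorem pi {κ : Type*} [Finite κ] {Y : κ → Type*} [∀ k, MeasurableSpace (Y k)]
    {G : ∀ k, Ω → Set (Y k)} (hG : ∀ k, CountablyUniformized (G k)) :
    CountablyUniformized fun ω => {y : ∀ k, Y k | ∀ k, y k ∈ G k ω} := by
  choose g hg hi h using hG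
  refine of_countable (κ := κ → ℕ) (fun s => ⋂ k, (fun p => (p.1, p.2 k)) ⁻¹' g k (s k))
    (fun s => MeasurableSet.iInter fun k => ?_) ?_ fun ω y => ?_
  · exact (measurable_fst.prodMk ((measurable_pi_apply k).comp measurable_snd)) (hg k (s k))
  · rintro s ⟨ω, y⟩ hy ⟨ω', y'⟩ hy' rfl
    rw [mem_iInter] at hy hy'
    refine Prod.ext rfl (funext fun k => ?_)
    exact congrArg Prod.snd (hi k (s k) (hy k) (hy' k) rfl)
  · simp only [mem_ofPred_eq, h, mem_iInter, mem_preimage]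
    exact Classical.skolem

theorem prod {G : Ω → Set Y} {H : Ω → Set Z} (hG : CountablyUniformized G)
    (hH : CountablyUniformized H) : CountablyUniformized fun ω => G ω ×ˢ H ω := by
  obtain ⟨g, hg, hgi, hgG⟩ := hG
  obtain ⟨h, hh, hhi, hhH⟩ := hH
  refine of_countable (κ := ℕ × ℕ)
    (fun s => (fun p : Ω × Y × Z => (p.1, p.2.1)) ⁻¹' g s.1 ∩ (fun p => (p.1, p.2.2)) ⁻¹' h s.2)
    (fun s => ?_) ?_ ?_
  · refine MeasurableSet.inter ?_ ?_
    · exact (by fun_prop : Measurable fun p : Ω × Y × Z => (p.1, p.2.1)) (hg _)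
    · exact (by fun_prop : Measurable fun p : Ω × Y × Z => (p.1, p.2.2)) (hh _)
  · rintro s ⟨ω, y, z⟩ ⟨hy, hz⟩ ⟨ω', y', z'⟩ ⟨hy', hz'⟩ rfl
    have h1 := congrArg Prod.snd (hgi _ hy hy' rfl)
    have h2 := congrArg Prod.snd (hhi _ hz hz' rfl)
    simp only at h1 h2
    rw [h1, h2]
  · simp [hgG, hhH]

/-- The composition with a Borel partial function. -/
theorem comp [StandardBorelSpace Ω] [StandardBorelSpace Y] [StandardBorelSpace Z]
    {G : Ω → Set Y} (hG : CountablyUniformized G) {H : Set (Y × Z)} (hH : MeasurableSet H)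
    (hHi : InjOn Prod.fst H) :
    CountablyUniformized fun ω => {z | ∃ y ∈ G ω, (y, z) ∈ H} := by
  obtain ⟨g, hg, hi, h⟩ := hG
  -- Within one piece, `ω` determines `y` and `y` determines `z`. Hence forgetting `y` is injective
  -- there and the image is Borel by Lusin–Souslin.
  have key : ∀ n (p q : Ω × Y × Z), p ∈ Prod.map id Prod.fst ⁻¹' g n ∩ Prod.snd ⁻¹' H →
      q ∈ Prod.map id Prod.fst ⁻¹' g n ∩ Prod.snd ⁻¹' H → p.1 = q.1 → p = q := by
    rintro n ⟨ω, y, z⟩ ⟨ω', y', z'⟩ ⟨hy, hz⟩ ⟨hy', hz'⟩ rfl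
    have h1 : y = y' := congrArg Prod.snd (hi _ hy hy' rfl)
    rw [show (y, z) = (y', z') from hHi hz hz' h1]
  refine ⟨fun n => Prod.map id Prod.snd '' (Prod.map id Prod.fst ⁻¹' g n ∩ Prod.snd ⁻¹' H),
    fun n => ?_, ?_, fun ω z => ?_⟩
  · refine MeasurableSet.image_of_measurable_injOn ?_ (measurable_id.prodMap measurable_snd)
      fun p hp q hq hpq => key n p q hp hq (Prod.ext_iff.1 hpq).1
    exact ((measurable_id.prodMap measurable_fst) (hg n)).inter (measurable_snd hH)
  · rintro n _ ⟨p, hp, rfl⟩ _ ⟨q, hq, rfl⟩ hpq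
    rw [key n p q hp hq hpq]
  · simp only [mem_ofPred_eq, h]
    constructor
    · rintro ⟨y, ⟨n, hn⟩, hz⟩
      exact ⟨n, (ω, y, z), ⟨hn, hz⟩, rfl⟩
    · rintro ⟨n, ⟨ω', y, z'⟩, ⟨hn, hz⟩, heq⟩
      simp only [Prod.map_apply, id_eq, Prod.mk.injEq] at heq
      obtain ⟨rfl, rfl⟩ := heq
      exact ⟨y, ⟨n, hn⟩, hz⟩

theorem image [StandardBorelSpace Ω] [StandardBorelSpace Y] [StandardBorelSpace Z]
    {G : Ω → Set Y} (hG : CountablyUniformized G) {φ : Y → Z} (hφ : Measurable φ) :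
    CountablyUniformized fun ω => φ '' G ω := by
  refine hG.comp (H := {p | φ p.1 = p.2}) ?_ ?_
  · exact measurableSet_eq_fun (hφ.comp measurable_fst) measurable_snd
  · rintro ⟨y, z⟩ (hz : φ y = z) ⟨y', z'⟩ (hz' : φ y' = z') (rfl : y = y')
    rw [← hz, ← hz']

/-- The event is the union of the domains of the partial functions, each an injective projection of
a Borel set. -/
theorem measurableSet_nonempty [StandardBorelSpace Ω] [StandardBorelSpace Y] {G : Ω → Set Y}
    (hG : CountablyUniformized G) : MeasurableSet {ω | (G ω).Nonempty} := by
  obtain ⟨g, hg, hi, h⟩ := hG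
  have : {ω | (G ω).Nonempty} = ⋃ n, Prod.fst '' g n := by
    ext ω
    simp only [mem_ofPred_eq, Set.Nonempty, h, mem_iUnion, mem_image, Prod.exists, exists_and_right,
      exists_eq_right]
    exact exists_comm
  rw [this]
  exact MeasurableSet.iUnion fun n => (hg n).image_of_measurable_injOn measurable_fst (hi n)

/-- A set has at least `n` elements iff its `n`-th power contains an injective tuple, which is a
nonemptiness event. -/
theorem measurableSet_le_encard [StandardBorelSpace Ω] [StandardBorelSpace Y] {G : Ω → Set Y}
    (hG : CountablyUniformized G) (n : ℕ) : MeasurableSet {ω | (n : ℕ∞) ≤ (G ω).encard} := by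
  have hinj : MeasurableSet {y : Fin n → Y | Function.Injective y} := by
    have : {y : Fin n → Y | Function.Injective y} =
        ⋂ (i) (j) (_ : i ≠ j), {y : Fin n → Y | y i = y j}ᶜ := by
      ext y
      simp only [mem_ofPred_eq, mem_iInter, mem_compl_iff, Function.Injective]
      exact ⟨fun h i j hij he => hij (h he), fun h i j he => not_not.1 fun hij => h i j hij he⟩
    rw [this]
    exact MeasurableSet.iInter fun i => MeasurableSet.iInter fun j => MeasurableSet.iInter fun _ =>
      (measurableSet_eq_fun (measurable_pi_apply i) (measurable_pi_apply j)).compl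
  convert ((pi fun _ : Fin n => hG).inter hinj).measurableSet_nonempty using 3 with ω
  constructor
  · intro h
    obtain ⟨t, ht, hn⟩ := exists_subset_encard_eq h
    have hfin : t.Finite := finite_of_encard_eq_coe hn
    have := hfin.fintype
    have hc : Fintype.card t = n := by
      rw [← hfin.cast_ncard_eq, ← Nat.card_coe_set_eq, Nat.card_eq_fintype_card] at hn
      exact_mod_cast hn
    let e := (Fintype.equivFinOfCardEq hc).symm
    exact ⟨fun i => e i, fun i => ht (e i).2, Subtype.val_injective.comp e.injective⟩
  · rintro ⟨y, hy, hyi⟩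
    calc (n : ℕ∞) = (range y).encard := by
          rw [← image_univ, hyi.encard_image, encard_univ]; simp
      _ ≤ _ := encard_le_encard (range_subset_iff.2 hy)

theorem measurableSet_encard_eq [StandardBorelSpace Ω] [StandardBorelSpace Y] {G : Ω → Set Y}
    (hG : CountablyUniformized G) (n : ℕ) : MeasurableSet {ω | (G ω).encard = n} := by
  have : {ω | (G ω).encard = n} =
      {ω | (n : ℕ∞) ≤ (G ω).encard} \ {ω | ((n + 1 : ℕ) : ℕ∞) ≤ (G ω).encard} := by
    ext ω
    simp only [mem_ofPred_eq, mem_sdiff, not_le]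
    rw [Nat.cast_add, Nat.cast_one, ENat.lt_add_one_iff (ENat.natCast_ne_top n), le_antisymm_iff,
      and_comm]
  rw [this]
  exact (hG.measurableSet_le_encard n).diff (hG.measurableSet_le_encard (n + 1))

end CountablyUniformized

/-! ### Coding finite bags by counts -/

section Bags

open TopologicalSpace

universe u

variable {X : Type u}

theorem measurable_bagCount [MeasurableSpace X] {F : Set X} (hF : MeasurableSet F) :
    Measurable[countingSigmaAlgebra X] fun B : Multiset X => bagCount B F := by
  let _ := countingSigmaAlgebra X
  exact measurable_to_countable' fun n =>
    MeasurableSpace.measurableSet_generateFrom ⟨F, hF, n, rfl⟩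

theorem bagCount_pos {B : Multiset X} {F : Set X} : 0 < bagCount B F ↔ ∃ x ∈ B, x ∈ F := by
  classical
  exact Multiset.countP_pos

theorem bagCount_val_toFinset {s : Set X} (hs : s.Finite) (F : Set X) :
    (bagCount hs.toFinset.val F : ℕ∞) = (s ∩ F).encard := by
  classical
  have : s ∩ F = ((hs.toFinset.filter fun x => x ∈ F : Finset X) : Set X) := by
    ext x
    simp
  rw [this, encard_coe_eq_coe_finsetCard, bagCount, Multiset.countP_eq_card_filter]
  simp [Finset.card]

/-- Finite bags over a standard Borel space can be mapped measurably to a standard Borel space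
such that the set of the elements depends on the code in a countably uniformized way. -/
theorem exists_measurable_code [MeasurableSpace X] [StandardBorelSpace X] :
    ∃ (κ : Type u) (_ : Countable κ) (c : Multiset X → κ → ℕ) (G : (κ → ℕ) → Set X),
      Measurable[countingSigmaAlgebra X] c ∧ CountablyUniformized G ∧
      ∀ B x, x ∈ G (c B) ↔ x ∈ B := by
  let _ := upgradeStandardBorel X
  let I := countableBasis X
  have hI : Countable I := (countable_countableBasis X).to_subtype
  let b : I → Set X := Subtype.val
  have hb : IsTopologicalBasis (range b) := by
    simpa [b, I] using isBasis_countableBasis X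
  have hbm : ∀ i, MeasurableSet (b i) := fun i => (hb.isOpen ⟨i, rfl⟩).measurableSet
  have hsep : ∀ x y : X, (∀ j, x ∈ b j → y ∈ b j) → x = y := by
    intro x y h
    by_contra hxy
    obtain ⟨_, ⟨j, rfl⟩, hx, hj⟩ := hb.exists_subset_of_mem_open
      (show x ∈ ({y} : Set X)ᶜ from hxy) isClosed_singleton.isOpen_compl
    exact hj (h j hx) rfl
  -- If `b i` isolates `x` in the bag, then `x ∈ b j` iff the bag meets `b i ∩ b j`. So the counts
  -- at `(i, ·)` list the basic neighbourhoods of `x`, which determine it, for arbitrary codes as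
  -- well.
  let g : I → Set ((I × I → ℕ) × X) := fun i =>
    {p | p.2 ∈ b i ∧ ∀ j, p.2 ∈ b j ↔ 0 < p.1 (i, j)}
  refine ⟨I × I, inferInstance, fun B p => bagCount B (b p.1 ∩ b p.2),
    fun ω => {x | ∃ i, (ω, x) ∈ g i}, ?_,
    .of_countable g (fun i => ?_) ?_ fun _ _ => Iff.rfl, fun B x => ?_⟩
  · exact @measurable_pi_lambda _ _ _ (countingSigmaAlgebra X) _ _ fun p =>
      measurable_bagCount ((hbm _).inter (hbm _))
  · refine (measurable_snd (hbm i)).inter ?_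
    change MeasurableSet {p : (I × I → ℕ) × X | ∀ j, p.2 ∈ b j ↔ 0 < p.1 (i, j)}
    rw [ofPred_forall]
    refine MeasurableSet.iInter fun j => MeasurableSet.iff (measurable_snd (hbm j)) ?_
    exact measurableSet_lt measurable_const ((measurable_pi_apply _).comp measurable_fst)
  · rintro i ⟨ω, x⟩ hx ⟨ω', y⟩ hy rfl
    rw [hsep x y fun j hj => (hy.2 j).2 ((hx.2 j).1 hj)]
  · simp only [g, mem_ofPred_eq, bagCount_pos]
    constructor
    · rintro ⟨i, hi, h⟩
      -- Every basic set containing this `y` has a positive count at `(i, ·)`, hence contains `x`;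
      -- so `y = x`.
      obtain ⟨y, hyB, hyi, -⟩ := (h i).1 hi
      rwa [← hsep y x fun j hj => (h j).2 ⟨y, hyB, hyi, hj⟩]
    · intro hx
      -- The other elements of the bag form a finite, hence closed, set, so some basic set isolates
      -- `x` from them.
      obtain ⟨_, ⟨i, rfl⟩, hxi, hi⟩ := hb.exists_subset_of_mem_open
        (show x ∈ (({y | y ∈ B} \ {x})ᶜ : Set X) by simp)
        ((Multiset.finite_toSet B).subset sdiff_subset).isClosed.isOpen_compl
      refine ⟨i, hxi, fun j => ⟨fun hj => ⟨x, hx, hxi, hj⟩, ?_⟩⟩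
      rintro ⟨y, hyB, hyi, hyj⟩
      have : y = x := not_not.1 fun hne => hi hyi ⟨hyB, hne⟩
      rwa [← this]

end Bags

/-! ### Measurability of Datalog queries -/

namespace DatalogProgram

variable {Att : Type*} {U : SortedUniverse Att} {τ ι : Schema Att}

theorem standardBorelSpace_dbFact (U : SortedUniverse Att) (σ : Schema Att) :
    StandardBorelSpace (DBFact U σ) := by
  have : Finite σ.Rel := σ.finite
  exact standardBorelSpace_sigma

/-- The tuples of domain values that match a tuple of terms under some valuation form a
measurable set if the values of each variable can be compared measurably. -/
theorem measurableSet_exists_valuation {W J : Type*} [MeasurableSpace W] [Finite J] {A : J → Att}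
    (π : ∀ j, W → U.dom (A j)) (hπ : ∀ j, Measurable (π j)) (u : J → DTerm U.carrier)
    (hu : ∀ x i j, u i = DTerm.var x → u j = DTerm.var x → BorelEquality U (A i) (A j)) :
    MeasurableSet {w | ∃ v : ℕ → U.carrier, ∀ j, (π j w : U.carrier) = (u j).eval v} := by
  classical
  have hset : {w | ∃ v : ℕ → U.carrier, ∀ j, (π j w : U.carrier) = (u j).eval v} =
      (⋂ j, {w | ∀ c, u j = DTerm.const c → (π j w : U.carrier) = c}) ∩
        ⋂ (x : ℕ) (i) (j) (_ : u i = DTerm.var x) (_ : u j = DTerm.var x),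
          {w | (π i w : U.carrier) = π j w} := by
    ext w
    simp only [mem_ofPred_eq, mem_inter_iff, mem_iInter]
    constructor
    · rintro ⟨v, hv⟩
      refine ⟨fun j c hj => ?_, fun x i j hi hj => ?_⟩
      · rw [hv, hj, DTerm.eval]
      · rw [hv, hv, hi, hj]
    · rintro ⟨hc, hx⟩
      -- Read the value of `x` off any position where it occurs; all such positions agree by `hx`.
      refine ⟨fun x => if h : ∃ i, u i = DTerm.var x then π h.choose w else U.nonempty.some,
        fun j => ?_⟩
      cases hj : u j with
      | const c => exact hc j c hj
      | var x =>
        have h : ∃ i, u i = DTerm.var x := ⟨j, hj⟩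
        simp only [DTerm.eval, dif_pos h]
        exact hx x j _ hj h.choose_spec
  rw [hset]
  refine (MeasurableSet.iInter fun j => ?_).inter (MeasurableSet.iInter fun x =>
    MeasurableSet.iInter fun i => MeasurableSet.iInter fun j => MeasurableSet.iInter fun hi =>
      MeasurableSet.iInter fun hj => ((hπ i).prodMk (hπ j)) (hu x i j hi hj))
  cases hj : u j with
  | var x => simp
  | const c =>
    -- The set is empty if `c` lies outside the domain.
    have hs : MeasurableSet {a : U.dom (A j) | (a : U.carrier) = c} :=
      Set.Subsingleton.measurableSet fun a ha b hb =>
        Subtype.ext (Eq.trans (b := c) ha (Eq.symm hb))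
    simpa [eq_comm] using hπ j hs

/-- The tuples for the body atoms of a rule. -/
abbrev BodyTuples (r : DRule U τ ι) : Type _ :=
  (∀ i : Fin r.edb.length, RelTuple U τ (r.edb.get i).rel) ×
    (∀ i : Fin r.idb.length, RelTuple U ι (r.idb.get i).rel)

/-- The tuples for the body and the head of a rule that match its atoms under some valuation. -/
def groundRule (r : DRule U τ ι) : Set (BodyTuples r × RelTuple U ι r.head.rel) :=
  {w | ∃ v : ℕ → U.carrier,
    (∀ i k, (w.1.1 i k : U.carrier) = ((r.edb.get i).args k).eval v) ∧
    (∀ i k, (w.1.2 i k : U.carrier) = ((r.idb.get i).args k).eval v) ∧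
    ∀ k, (w.2 k : U.carrier) = (r.head.args k).eval v}

theorem measurableSet_groundRule {r : DRule U τ ι}
    (hr : ∀ x A B, r.OccursAt x A → r.OccursAt x B → BorelEquality U A B) :
    MeasurableSet (groundRule r) := by
  let J := (Σ i : Fin r.edb.length, Fin (τ.arity (r.edb.get i).rel)) ⊕
    (Σ i : Fin r.idb.length, Fin (ι.arity (r.idb.get i).rel)) ⊕ Fin (ι.arity r.head.rel)
  let A : J → Att := Sum.elim (fun p => τ.attr (r.edb.get p.1).rel p.2)
    (Sum.elim (fun p => ι.attr (r.idb.get p.1).rel p.2) fun k => ι.attr r.head.rel k)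
  let u : J → DTerm U.carrier := Sum.elim (fun p => (r.edb.get p.1).args p.2)
    (Sum.elim (fun p => (r.idb.get p.1).args p.2) fun k => r.head.args k)
  let π : ∀ j, BodyTuples r × RelTuple U ι r.head.rel → U.dom (A j) := fun j => match j with
    | .inl p => fun w => w.1.1 p.1 p.2
    | .inr (.inl p) => fun w => w.1.2 p.1 p.2
    | .inr (.inr k) => fun w => w.2 k
  have hπ : ∀ j, Measurable (π j) := by
    rintro (p | p | k)
    · exact (measurable_pi_apply p.2).comp ((measurable_pi_apply p.1).comp
        (measurable_fst.comp measurable_fst))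
    · exact (measurable_pi_apply p.2).comp ((measurable_pi_apply p.1).comp
        (measurable_snd.comp measurable_fst))
    · exact (measurable_pi_apply k).comp measurable_snd
  have hocc : ∀ x j, u j = DTerm.var x → r.OccursAt x (A j) := by
    rintro x (p | p | k) h
    · exact Or.inr (Or.inl ⟨_, List.get_mem _ _, p.2, h, rfl⟩)
    · exact Or.inr (Or.inr ⟨_, List.get_mem _ _, p.2, h, rfl⟩)
    · exact Or.inl ⟨k, h, rfl⟩
  convert measurableSet_exists_valuation π hπ u
    fun x i j hi hj => hr x _ _ (hocc x i hi) (hocc x j hj) using 1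
  ext w
  refine exists_congr fun v => ⟨fun ⟨h1, h2, h3⟩ => ?_, fun h => ⟨fun i k => h (.inl ⟨i, k⟩),
    fun i k => h (.inr (.inl ⟨i, k⟩)), fun k => h (.inr (.inr k))⟩⟩
  rintro (p | p | k)
  exacts [h1 _ _, h2 _ _, h3 _]

/-- The body tuples fix the valuation on all body variables, and by safety these include the head
variables. -/
theorem injOn_fst_groundRule (r : DRule U τ ι) : InjOn Prod.fst (groundRule r) := by
  rintro ⟨b, t⟩ ⟨v, h1, h2, h3⟩ ⟨b', t'⟩ ⟨v', h1', h2', h3'⟩ (rfl : b = b')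
  have hv : ∀ x B, ((∃ a ∈ r.edb, a.OccursAt x B) ∨ ∃ a ∈ r.idb, a.OccursAt x B) →
      v x = v' x := by
    rintro x B (⟨a, ha, k, hk, -⟩ | ⟨a, ha, k, hk, -⟩) <;> obtain ⟨i, rfl⟩ := List.get_of_mem ha
    · have := (h1 i k).symm.trans (h1' i k)
      rwa [hk] at this
    · have := (h2 i k).symm.trans (h2' i k)
      rwa [hk] at this
  refine Prod.ext rfl (funext fun k => Subtype.ext ?_)
  refine (h3 k).trans (Eq.trans ?_ (h3' k).symm)
  cases hk : r.head.args k with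
  | const c => rfl
  | var x =>
    rcases r.safe x _ ⟨k, hk, rfl⟩ with ⟨a, ha, B, h⟩ | ⟨a, ha, B, h⟩
    · exact hv x B (Or.inl ⟨a, ha, h⟩)
    · exact hv x B (Or.inr ⟨a, ha, h⟩)

/-- This puts a round into the shape of the closure lemmas: product over the body atoms, composition
with `groundRule r`, image under `Sigma.mk`, union over the rules. -/
theorem mem_consequence_iff (P : DatalogProgram U τ ι) {D : Set (DBFact U τ)}
    {I : Set (DBFact U ι)} {f : DBFact U ι} :
    f ∈ P.consequence D I ↔ ∃ r ∈ P.rules, ∃ t, (∃ b : BodyTuples r,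
      ((∀ i, (⟨_, b.1 i⟩ : DBFact U τ) ∈ D) ∧ ∀ i, (⟨_, b.2 i⟩ : DBFact U ι) ∈ I) ∧
        (b, t) ∈ groundRule r) ∧ ⟨r.head.rel, t⟩ = f := by
  constructor
  · rintro ⟨r, hr, v, h1, h2, t, rfl, h3⟩
    have h1 : ∀ i, ∃ s : RelTuple U τ (r.edb.get i).rel, (⟨_, s⟩ : DBFact U τ) ∈ D ∧
        ∀ k, (s k : U.carrier) = ((r.edb.get i).args k).eval v := fun i => by
      obtain ⟨_, hD, s, rfl, hs⟩ := h1 _ (List.get_mem r.edb i)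
      exact ⟨s, hD, hs⟩
    have h2 : ∀ i, ∃ s : RelTuple U ι (r.idb.get i).rel, (⟨_, s⟩ : DBFact U ι) ∈ I ∧
        ∀ k, (s k : U.carrier) = ((r.idb.get i).args k).eval v := fun i => by
      obtain ⟨_, hI, s, rfl, hs⟩ := h2 _ (List.get_mem r.idb i)
      exact ⟨s, hI, hs⟩
    choose p hpD hp using h1
    choose q hqI hq using h2
    exact ⟨r, hr, t, ⟨(p, q), ⟨hpD, hqI⟩, v, hp, hq, h3⟩, rfl⟩
  · rintro ⟨r, hr, t, ⟨b, ⟨hD, hI⟩, v, h1, h2, h3⟩, rfl⟩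
    refine ⟨r, hr, v, fun a ha => ?_, fun a ha => ?_, t, rfl, h3⟩
    · obtain ⟨i, rfl⟩ := List.get_of_mem ha
      exact ⟨_, hD i, b.1 i, rfl, h1 i⟩
    · obtain ⟨i, rfl⟩ := List.get_of_mem ha
      exact ⟨_, hI i, b.2 i, rfl, h2 i⟩

theorem countablyUniformized_consequence {P : DatalogProgram U τ ι} (hP : P.WellSorted)
    {Ω : Type*} [MeasurableSpace Ω] [StandardBorelSpace Ω] {D : Ω → Set (DBFact U τ)}
    {I : Ω → Set (DBFact U ι)} (hD : CountablyUniformized D) (hI : CountablyUniformized I) :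
    CountablyUniformized fun ω => P.consequence (D ω) (I ω) := by
  have := standardBorelSpace_dbFact U ι
  have : Countable {r // r ∈ P.rules} := (List.finite_toSet P.rules).countable.to_subtype
  have hmk : ∀ {σ : Schema Att} (S : σ.Rel), Function.Injective
      (Sigma.mk S : RelTuple U σ S → DBFact U σ) := fun S => sigma_mk_injective
  have key := CountablyUniformized.iUnion (κ := {r // r ∈ P.rules}) fun r =>
    (((CountablyUniformized.pi fun i : Fin r.1.edb.length =>
      hD.preimage (measurable_sigmaMk (r.1.edb.get i).rel) (hmk _)).prod
      (CountablyUniformized.pi fun i : Fin r.1.idb.length =>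
      hI.preimage (measurable_sigmaMk (r.1.idb.get i).rel) (hmk _))).comp
      (measurableSet_groundRule (hP r.1 r.2)) (injOn_fst_groundRule r.1)).image
      (measurable_sigmaMk (E := RelTuple U ι) r.1.head.rel)
  convert key using 2 with ω
  ext f
  rw [mem_consequence_iff]
  simp only [mem_iUnion, Subtype.exists]
  exact exists_congr fun r => exists_prop.symm

/-- The facts that can be derived in at most `n` rounds. -/
def stage (P : DatalogProgram U τ ι) (D : Set (DBFact U τ)) : ℕ → Set (DBFact U ι)
  | 0 => ∅
  | n + 1 => P.consequence D (P.stage D n)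

theorem monotone_stage (P : DatalogProgram U τ ι) (D : Set (DBFact U τ)) :
    Monotone (P.stage D) := by
  refine monotone_nat_of_le_succ fun n => ?_
  induction n with
  | zero => exact empty_subset _
  | succ n ih => exact (P.consequence D).monotone ih

/-- Bodies are finite and stages increase, so the premises of a rule application in the union
already lie in one stage; the union is therefore closed under the rules. -/
theorem derived_eq_iUnion_stage (P : DatalogProgram U τ ι) (D : Set (DBFact U τ)) :
    P.derived D = ⋃ n, P.stage D n := by
  apply subset_antisymm
  · refine OrderHom.lfp_le _ fun f hf => ?_
    obtain ⟨r, hr, t, ⟨b, ⟨hD, hI⟩, hb⟩, rfl⟩ := P.mem_consequence_iff.1 hf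
    simp only [mem_iUnion] at hI
    choose m hm using hI
    obtain ⟨N, hN⟩ := (finite_range m).bddAbove
    exact mem_iUnion.2 ⟨N + 1, P.mem_consequence_iff.2
      ⟨r, hr, t, ⟨b, ⟨hD, fun i => P.monotone_stage D (hN ⟨i, rfl⟩) (hm i)⟩, hb⟩, rfl⟩⟩
  · refine iUnion_subset fun n => ?_
    induction n with
    | zero => exact empty_subset _
    | succ n ih => exact ((P.consequence D).monotone ih).trans (OrderHom.map_lfp _).le

theorem countablyUniformized_derived {P : DatalogProgram U τ ι} (hP : P.WellSorted)
    {Ω : Type*} [MeasurableSpace Ω] [StandardBorelSpace Ω] {D : Ω → Set (DBFact U τ)}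
    (hD : CountablyUniformized D) : CountablyUniformized fun ω => P.derived (D ω) := by
  simp only [derived_eq_iUnion_stage]
  refine .iUnion fun n => ?_
  induction n with
  | zero => exact ⟨fun _ => ∅, by simp, by simp, by simp [stage]⟩
  | succ n ih => exact countablyUniformized_consequence hP hD ih

end DatalogProgram

theorem mainTheorem3 {Att : Type*} (U : SortedUniverse Att) {τ ι : Schema Att}
    (P : DatalogProgram U τ ι) (hP : P.WellSorted) (R : ι.Rel) :
    Measurable (P.query R) := by
  have := DatalogProgram.standardBorelSpace_dbFact U τ
  have := DatalogProgram.standardBorelSpace_dbFact U (ι.single R)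
  obtain ⟨κ, _, c, G, hc, hG, hcG⟩ := exists_measurable_code (X := DBFact U τ)
  refine measurable_generateFrom ?_
  rintro _ ⟨F, hF, n, rfl⟩
  let φ : DBFact U (ι.single R) → DBFact U ι := fun f => ⟨R, f.2⟩
  have hφ : Measurable φ := measurable_of_forall_sigmaMk fun _ =>
    measurable_sigmaMk (E := RelTuple U ι) R
  have hφi : Function.Injective φ := by
    rintro ⟨⟨⟩, t⟩ ⟨⟨⟩, t'⟩ h
    have h : t = t' := eq_of_heq (Sigma.mk.inj h).2
    rw [h]
  -- This concerns all `ω`, also those coding no bag, where the set may be infinite; hence the count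
  -- by `encard`.
  have key := (((DatalogProgram.countablyUniformized_derived hP hG).preimage hφ hφi).inter
    hF).measurableSet_encard_eq n
  suffices h : P.query R ⁻¹' {B | bagCount B F = n} =
      c ⁻¹' {ω | (φ ⁻¹' P.derived (G ω) ∩ F).encard = n} from
    (congrArg (MeasurableSet (α := DBInstance U τ)) h).mpr (hc key)
  ext D
  have hD : G (c D) = D.facts := Set.ext fun f => hcG D f
  change bagCount (P.answers_finite R D).toFinset.val F = n ↔
    (φ ⁻¹' P.derived (G (c D)) ∩ F).encard = n
  rw [hD, ← Nat.cast_inj (R := ℕ∞), bagCount_val_toFinset]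
  rfl
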